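/- Let $N\ge 1$ and $B_1=\{z\in\mathbb R^N:|z|<1\}$. Put $c_N=\pi^{-N/2}\Gamma(N/2)$, $\rho_N=2\log 2+\psi(N/2)-\gamma$, where $\psi=\Gamma'/\Gamma$ and $\gamma$ is the Euler–Mascheroni constant, and $k(z)=c_N|z|^{-N}\chi_{B_1}(z)$, $j(z)=c_N|z|^{-N}\chi_{\mathbb R^N\setminus B_1}(z)$. Let $$\mathcal E(u,v)=\frac12\iint_{\mathbb R^N\times\mathbb R^N}(u(x)-u(y))(v(x)-v(y))\,k(x-y)\,dx\,dy,$$ let $\mathbb H(\mathbb R^N)$ be the space of all $u\in L^2(\mathbb R^N)$ with $\mathcal E(u,u)<\infty$, and for an open set $\Omega\subset\mathbb R^N$ let $\mathbb H(\Omega)$ be the space of all $u\in\mathbb H(\mathbb R^N)$ with $u=0$ a.e. in $\mathbb R^N\setminus\Omega$. The bilinear form of the logarithmic Laplacian $L_\Delta$ is $$\mathcal E_L(u,v)=\mathcal E(u,v)-\iint_{\mathbb R^N\times\mathbb R^N}u(x)v(y)\,j(x-y)\,dx\,dy+\rho_N\int_{\mathbb R^N}uv\,dx .$$ For $\Omega$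 bounded and open, $g\in L^2(\Omega)$ and $u\in\mathbb H(\mathbb R^N)$, one says that $L_\Delta u\ge g$ in $\Omega$ if $\mathcal E_L(u,\varphi)\ge\int_\Omega g\varphi\,dx$ for every nonnegative $\varphi\in\mathbb H(\Omega)$. Let $H\subset\mathbb R^N$ be an open half-space with boundary hyperplane $T=\partial H$, and let $x\mapsto\bar x$ be the reflection with respect to $T$. Let $\Omega\subset H$ be a bounded open set with Lipschitz boundary (not necessarily connected), let $V\in L^\infty(\Omega)$, and let $u\in C(\mathbb R^N)\cap\mathbb H(\mathbb R^N)$ be antisymmetric with respect to $T$, that is, $u(\bar x)=-u(x)$ for a.e. $x\in\mathbb R^N$. Suppose that $L_\Delta u\ge Vu$ in $\Omega$ and that $u\ge 0$ in $H$. Then either $u>0$ everywhere in $\Omega$ or $u\equiv0$ in $\mathbb R^N$. -/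

import Mathlib

open MeasureTheory

noncomputable section

namespace LogLap

/-- The normalising constant `c_N = π^{-N/2} Γ(N/2)` of the logarithmic Laplacian. -/
def cN (N : ℕ) : ℝ := Real.pi ^ (-(N : ℝ) / 2) * Real.Gamma ((N : ℝ) / 2)

/-- The zero-order constant `ρ_N = 2 log 2 + ψ(N/2) - γ`, where `ψ = Γ'/Γ` is the digamma function
and `γ` is the Euler-Mascheroni constant. -/
def rhoN (N : ℕ) : ℝ :=
  2 * Real.log 2 + logDeriv Real.Gamma ((N : ℝ) / 2) - Real.eulerMascheroniConstant

/-- The short-range kernel `k(z) = c_N |z|^{-N}` on the open unit ball, `0` elsewhere. -/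
def kernelK {N : ℕ} (z : EuclideanSpace ℝ (Fin N)) : ℝ :=
  (Metric.ball (0 : EuclideanSpace ℝ (Fin N)) 1).indicator (fun z => cN N / ‖z‖ ^ N) z

/-- The long-range kernel `j(z) = c_N |z|^{-N}` off the open unit ball, `0` on it. -/
def kernelJ {N : ℕ} (z : EuclideanSpace ℝ (Fin N)) : ℝ :=
  (Metric.ball (0 : EuclideanSpace ℝ (Fin N)) 1)ᶜ.indicator (fun z => cN N / ‖z‖ ^ N) z

/-- The bilinear form `𝓔(u,v) = ½ ∬ (u(x) - u(y)) (v(x) - v(y)) k(x - y) dx dy`. -/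
def energy {N : ℕ} (u v : EuclideanSpace ℝ (Fin N) → ℝ) : ℝ :=
  (1 / 2) * ∫ p : EuclideanSpace ℝ (Fin N) × EuclideanSpace ℝ (Fin N),
    (u p.1 - u p.2) * (v p.1 - v p.2) * kernelK (p.1 - p.2)

/-- Membership in `ℍ(ℝ^N)`: `u ∈ L²` and `𝓔(u,u) < ∞`. The integrand of `𝓔(u,u)` is nonnegative and
measurable, so that finiteness of the double integral is integrability. -/
def MemH {N : ℕ} (u : EuclideanSpace ℝ (Fin N) → ℝ) : Prop :=
  MemLp u 2 volume ∧
    Integrable (fun p : EuclideanSpace ℝ (Fin N) × EuclideanSpace ℝ (Fin N) =>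
      (u p.1 - u p.2) * (u p.1 - u p.2) * kernelK (p.1 - p.2)) volume

/-- Membership in `ℍ(Ω)`: `u ∈ ℍ(ℝ^N)` and `u = 0` a.e. in the complement of `Ω`. -/
def MemHOn {N : ℕ} (Ω : Set (EuclideanSpace ℝ (Fin N)))
    (u : EuclideanSpace ℝ (Fin N) → ℝ) : Prop :=
  MemH u ∧ ∀ᵐ x ∂(volume : Measure (EuclideanSpace ℝ (Fin N))), x ∉ Ω → u x = 0

/-- The bilinear form of the logarithmic Laplacian,
`𝓔_L(u,v) = 𝓔(u,v) - ∬ u(x) v(y) j(x - y) dx dy + ρ_N ∫ u v dx`. All three integrals converge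
absolutely if `u ∈ ℍ(ℝ^N)` and `v ∈ ℍ(Ω)` with `Ω` bounded. -/
def energyL {N : ℕ} (u v : EuclideanSpace ℝ (Fin N) → ℝ) : ℝ :=
  energy u v
    - (∫ p : EuclideanSpace ℝ (Fin N) × EuclideanSpace ℝ (Fin N),
        u p.1 * v p.2 * kernelJ (p.1 - p.2))
    + rhoN N * ∫ x : EuclideanSpace ℝ (Fin N), u x * v x

/-- `L_Δ u ≥ g` in `Ω` in the weak sense (for `g ∈ L²(Ω)`): `u ∈ ℍ(ℝ^N)` and
`𝓔_L(u,φ) ≥ ∫_Ω g φ dx` for all nonnegative `φ ∈ ℍ(Ω)`. -/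
def IsWeakSupersolution {N : ℕ} (Ω : Set (EuclideanSpace ℝ (Fin N)))
    (u g : EuclideanSpace ℝ (Fin N) → ℝ) : Prop :=
  MemH u ∧ ∀ φ : EuclideanSpace ℝ (Fin N) → ℝ, MemHOn Ω φ → 0 ≤ᵐ[volume] φ →
    ∫ x in Ω, g x * φ x ≤ energyL u φ

/-- The open half-space `{x : ⟨e, x⟩ > c}`, for a unit vector `e`. -/
def halfSpace {N : ℕ} (e : EuclideanSpace ℝ (Fin N)) (c : ℝ) : Set (EuclideanSpace ℝ (Fin N)) :=
  {x | c < inner ℝ e x}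

/-- The reflection `x ↦ x̄` with respect to the hyperplane `{x : ⟨e, x⟩ = c}`, for a unit
vector `e`. -/
def reflect {N : ℕ} (e : EuclideanSpace ℝ (Fin N)) (c : ℝ) (x : EuclideanSpace ℝ (Fin N)) :
    EuclideanSpace ℝ (Fin N) :=
  x - (2 * (inner ℝ e x - c)) • e

/-- `u` is antisymmetric with respect to `{x : ⟨e, x⟩ = c}`: `u(x̄) = -u(x)` for a.e. `x`. -/
def IsAntisymmetric {N : ℕ} (e : EuclideanSpace ℝ (Fin N)) (c : ℝ)
    (u : EuclideanSpace ℝ (Fin N) → ℝ) : Prop :=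
  ∀ᵐ x ∂(volume : Measure (EuclideanSpace ℝ (Fin N))), u (reflect e c x) = -u x

/-- `Ω` has Lipschitz boundary: near each boundary point, `Ω` is, in suitable orthonormal
coordinates, the region strictly below the graph of a Lipschitz function. Here `ν` is the vertical
direction, and `x - ⟨ν, x⟩ ν` is the horizontal part of `x`. -/
def HasLipschitzBoundary {N : ℕ} (Ω : Set (EuclideanSpace ℝ (Fin N))) : Prop :=
  ∀ p ∈ frontier Ω, ∃ (ν : EuclideanSpace ℝ (Fin N)) (f : EuclideanSpace ℝ (Fin N) → ℝ)
    (K : NNReal) (r : ℝ), ‖ν‖ = 1 ∧ LipschitzWith K f ∧ 0 < r ∧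
      ∀ x ∈ Metric.ball p r, x ∈ Ω ↔ inner ℝ ν x < f (x - (inner ℝ ν x : ℝ) • ν)

end LogLap

end

/-! Suppose `u` vanishes at `x₀ ∈ Ω` but is positive at some `x₁ ∈ H`. The inequality is tested with
`φ = (w - |u|)⁺`, where `w` is a cone of height `ε` over a small ball of radius `r` about `x₀`.
Where `φ > 0` one has `0 ≤ u ≤ w ≤ ε`, so for fixed `r` the `V` term, the `ρ_N` term and the local
energy are all `O(ε) ∫ φ`; the singularity of `k` is harmless because `w` is Lipschitz and `|z|
k(z)` is integrable. The values of `u` off the ball of radius `2r` enter through both `k` and `j`,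
and together give minus the integral of `φ` against a potential with the full kernel `c_N |z|^{-N}`
(`energyL_le`).

That potential is bounded below by some `m > 0` (`exists_le_integral_indicator_mul_kernelOff`).
Pairing `x` with its reflection, antisymmetry leaves a difference of kernels that is positive in
`H`, with a definite gain near `x₁`. The only loss comes from the mirror image of the removed ball,
and its size tends to zero with `r`.

Since `m` and `r` do not depend on `ε`, this yields `m ∫ φ ≤ O(ε) ∫ φ` with `∫ φ > 0`, which is
absurd for small `ε`. Hence `u = 0` on `H`, and antisymmetry carries this to the whole space. -/

namespace LogLap

open Metric Set

/-! ### Kernels and their integrability -/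

section Kernels

variable {N : ℕ}

/-- The full kernel `c_N |z|^{-N}`. -/
noncomputable def kernelFull (z : EuclideanSpace ℝ (Fin N)) : ℝ := cN N / ‖z‖ ^ N

lemma cN_pos (hN : 0 < N) : 0 < cN N :=
  mul_pos (Real.rpow_pos_of_pos Real.pi_pos _) (Real.Gamma_pos_of_pos (by positivity))

lemma kernelFull_nonneg (hN : 0 < N) (z : EuclideanSpace ℝ (Fin N)) : 0 ≤ kernelFull z :=
  div_nonneg (cN_pos hN).le (by positivity)

lemma kernelK_nonneg (hN : 0 < N) (z : EuclideanSpace ℝ (Fin N)) : 0 ≤ kernelK z :=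
  indicator_nonneg (fun z _ => kernelFull_nonneg hN z) z

lemma kernelJ_nonneg (hN : 0 < N) (z : EuclideanSpace ℝ (Fin N)) : 0 ≤ kernelJ z :=
  indicator_nonneg (fun z _ => kernelFull_nonneg hN z) z

lemma kernelK_add_kernelJ (z : EuclideanSpace ℝ (Fin N)) :
    kernelK z + kernelJ z = kernelFull z :=
  indicator_self_add_compl_apply _ _ z

lemma kernelK_sub_comm (x y : EuclideanSpace ℝ (Fin N)) : kernelK (x - y) = kernelK (y - x) := by
  simp only [kernelK, indicator, mem_ball_zero_iff, norm_sub_rev x y]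

lemma measurable_kernelFull : Measurable (kernelFull : EuclideanSpace ℝ (Fin N) → ℝ) := by
  unfold kernelFull; fun_prop

lemma measurable_kernelK : Measurable (kernelK : EuclideanSpace ℝ (Fin N) → ℝ) :=
  measurable_kernelFull.indicator measurableSet_ball

lemma continuousAt_kernelFull {z : EuclideanSpace ℝ (Fin N)} (hz : z ≠ 0) :
    ContinuousAt kernelFull z := by
  unfold kernelFull
  exact continuousAt_const.div (by fun_prop) (by positivity)

/-- The condition `z ≠ 0` matters: division by zero makes `kernelFull 0 = 0`. -/
lemma kernelFull_lt_of_norm_lt (hN : 0 < N) {z z' : EuclideanSpace ℝ (Fin N)} (hz : z ≠ 0)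
    (h : ‖z‖ < ‖z'‖) : kernelFull z' < kernelFull z := by
  have : 0 < ‖z‖ := norm_pos_iff.2 hz
  exact div_lt_div_of_pos_left (cN_pos hN) (by positivity)
    (pow_lt_pow_left₀ h (norm_nonneg _) hN.ne')

/-- The part of the full kernel off the open ball of radius `r`. -/
noncomputable def kernelOff (r : ℝ) : EuclideanSpace ℝ (Fin N) → ℝ :=
  (ball 0 r)ᶜ.indicator kernelFull

lemma measurable_kernelOff (r : ℝ) : Measurable (kernelOff r : EuclideanSpace ℝ (Fin N) → ℝ) :=
  measurable_kernelFull.indicator measurableSet_ball.compl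

/-- The square decays like `|z|^{-2N}` and is compared with `(1 + |z|)^{-2N}`. Square integrability
is the right notion, since `|z|^{-N}` is not integrable at infinity and `u` is only in `L²`. -/
lemma memLp_kernelOff (hN : 0 < N) {r : ℝ} (hr : 0 < r) :
    MemLp (kernelOff r : EuclideanSpace ℝ (Fin N) → ℝ) 2 := by
  rw [memLp_two_iff_integrable_sq (measurable_kernelOff r).aestronglyMeasurable]
  have hfin : (Module.finrank ℝ (EuclideanSpace ℝ (Fin N)) : ℝ) < (2 * N : ℕ) := by
    rw [finrank_euclideanSpace_fin]; exact_mod_cast (by omega)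
  have hint := (integrable_one_add_norm (μ := (volume : Measure (EuclideanSpace ℝ (Fin N))))
    hfin).const_mul ((cN N) ^ 2 * (1 + r⁻¹) ^ (2 * N))
  refine hint.mono' ((measurable_kernelOff r).pow_const 2).aestronglyMeasurable
    (Filter.Eventually.of_forall fun z => ?_)
  rw [Real.norm_of_nonneg (sq_nonneg _), Real.rpow_neg (by positivity), Real.rpow_natCast]
  by_cases hz : z ∈ (ball (0 : EuclideanSpace ℝ (Fin N)) r)ᶜ
  · have hzr : r ≤ ‖z‖ := by simpa using hz
    have hz0 : 0 < ‖z‖ := hr.trans_le hzr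
    have h1 : 1 + ‖z‖ ≤ (1 + r⁻¹) * ‖z‖ := by
      have : 1 ≤ r⁻¹ * ‖z‖ := by rw [inv_mul_eq_div, le_div_iff₀ hr]; linarith
      linarith
    have h2 := pow_le_pow_left₀ (by positivity) h1 (2 * N)
    rw [kernelOff, indicator_of_mem hz, kernelFull, div_pow, ← pow_mul, mul_comm N 2,
      mul_assoc, div_eq_mul_inv]
    refine mul_le_mul_of_nonneg_left ?_ (sq_nonneg _)
    rw [← div_eq_mul_inv, le_div_iff₀ (by positivity), inv_mul_le_iff₀ (by positivity), mul_comm,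
      ← mul_pow]
    simpa only [mul_comm] using h2
  · rw [kernelOff, indicator_of_notMem hz, zero_pow two_ne_zero]
    positivity

/-- In polar coordinates the radial density `t^{N-1} · t · c_N t^{-N}` is the constant `c_N` on
`(0,1)`. -/
lemma integrable_norm_mul_kernelK [Nontrivial (EuclideanSpace ℝ (Fin N))] (hN : 0 < N) :
    Integrable (fun z : EuclideanSpace ℝ (Fin N) => ‖z‖ * kernelK z) := by
  have key : (fun z : EuclideanSpace ℝ (Fin N) => ‖z‖ * kernelK z) =
      fun z => (fun t : ℝ => t * (Iio (1 : ℝ)).indicator (fun t => cN N / t ^ N) t) ‖z‖ := by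
    funext z
    simp only [kernelK, indicator, mem_ball_zero_iff, mem_Iio]
  rw [key, integrable_fun_norm_addHaar volume
    (f := fun t : ℝ => t * (Iio (1 : ℝ)).indicator (fun t => cN N / t ^ N) t),
    finrank_euclideanSpace_fin]
  have h : IntegrableOn (fun _ : ℝ => cN N) (Ioo 0 1) := by simp
  rw [← integrable_indicator_iff measurableSet_Ioi]
  rw [← integrable_indicator_iff measurableSet_Ioo] at h
  convert h using 1
  funext t
  by_cases ht : 0 < t
  · by_cases ht1 : t < 1
    · have : t ^ N = t ^ (N - 1) * t := by rw [← pow_succ, Nat.sub_add_cancel hN]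
      simp only [indicator, mem_Ioi, ht, mem_Iio, ht1, mem_Ioo, and_self, if_true, smul_eq_mul,
        this]
      field_simp
    · simp [indicator, ht, ht1]
  · simp [indicator, ht]

end Kernels

/-! ### Convolution-type double integrals -/

section Products

variable {N : ℕ}

lemma integrable_mul_comp_sub {f g : EuclideanSpace ℝ (Fin N) → ℝ}
    (hf : Integrable f) (hg : Integrable g) :
    Integrable (fun p : EuclideanSpace ℝ (Fin N) × EuclideanSpace ℝ (Fin N) =>
      f p.2 * g (p.1 - p.2)) :=
  hf.convolution_integrand (ContinuousLinearMap.mul ℝ ℝ) hg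

lemma integral_mul_comp_sub {f g : EuclideanSpace ℝ (Fin N) → ℝ}
    (hf : Integrable f) (hg : Integrable g) :
    ∫ p : EuclideanSpace ℝ (Fin N) × EuclideanSpace ℝ (Fin N), f p.2 * g (p.1 - p.2) =
      (∫ z, g z) * ∫ y, f y := by
  have h := integrable_mul_comp_sub hf hg
  rw [Measure.volume_eq_prod] at h ⊢
  rw [integral_prod_symm _ h]
  simp_rw [integral_const_mul, integral_sub_right_eq_self g]
  rw [integral_mul_const, mul_comm]

/-- Dominated by `|f(y)| (u(x)² + g(x - y)²)`: a tensor product plus a convolution integrand. -/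
lemma integrable_mul_mul_comp_sub {u f g : EuclideanSpace ℝ (Fin N) → ℝ}
    (hu : MemLp u 2) (hf : Integrable f) (hg : MemLp g 2) :
    Integrable (fun p : EuclideanSpace ℝ (Fin N) × EuclideanSpace ℝ (Fin N) =>
      u p.1 * f p.2 * g (p.1 - p.2)) := by
  have h1 := integrable_mul_comp_sub hf.norm hg.integrable_sq
  have h2 := hu.integrable_sq.mul_prod hf.norm
  rw [← Measure.volume_eq_prod] at h2
  refine (h1.add h2).mono' ?_ (Filter.Eventually.of_forall fun p => ?_)
  · have hp : AEStronglyMeasurable (fun p : EuclideanSpace ℝ (Fin N) ×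
        EuclideanSpace ℝ (Fin N) => f p.2 * g (p.1 - p.2)) (volume.prod volume) :=
      hf.aestronglyMeasurable.convolution_integrand (ContinuousLinearMap.mul ℝ ℝ)
        hg.aestronglyMeasurable
    simp_rw [mul_assoc]
    exact hu.aestronglyMeasurable.comp_fst.mul hp
  · simp only [Pi.add_apply, norm_mul, Real.norm_eq_abs]
    have := mul_nonneg (abs_nonneg (f p.2)) (sq_nonneg (|u p.1| - |g (p.1 - p.2)|))
    have := mul_nonneg (abs_nonneg (f p.2)) (sq_nonneg (|u p.1|))
    have := mul_nonneg (abs_nonneg (f p.2)) (sq_nonneg (|g (p.1 - p.2)|))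
    rw [← sq_abs (u p.1), ← sq_abs (g _)]
    nlinarith

lemma integral_mul_mul_comp_sub {u f g : EuclideanSpace ℝ (Fin N) → ℝ}
    (hu : MemLp u 2) (hf : Integrable f) (hg : MemLp g 2) :
    ∫ p : EuclideanSpace ℝ (Fin N) × EuclideanSpace ℝ (Fin N), u p.1 * f p.2 * g (p.1 - p.2) =
      ∫ y, f y * ∫ x, u x * g (x - y) := by
  have h := integrable_mul_mul_comp_sub hu hf hg
  rw [Measure.volume_eq_prod] at h ⊢
  rw [integral_prod_symm _ h]
  refine integral_congr_ae (Filter.Eventually.of_forall fun y => ?_)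
  dsimp only
  rw [← integral_const_mul]
  congr 1; funext x; ring

lemma integrable_mul_integral_mul_comp_sub {u f g : EuclideanSpace ℝ (Fin N) → ℝ}
    (hu : MemLp u 2) (hf : Integrable f) (hg : MemLp g 2) :
    Integrable (fun y => f y * ∫ x, u x * g (x - y)) := by
  have h := integrable_mul_mul_comp_sub hu hf hg
  rw [Measure.volume_eq_prod] at h
  refine h.integral_prod_right.congr (Filter.Eventually.of_forall fun y => ?_)
  dsimp only
  rw [← integral_const_mul]
  congr 1; funext x; ring

lemma integrable_mul_comp_sub_right {u g : EuclideanSpace ℝ (Fin N) → ℝ}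
    (hu : MemLp u 2) (hg : MemLp g 2) (y : EuclideanSpace ℝ (Fin N)) :
    Integrable (fun x => u x * g (x - y)) :=
  hu.integrable_mul (hg.comp_measurePreserving (measurePreserving_sub_right volume y))

end Products

/-! ### Membership in the energy space -/

section EnergySpace

variable {N : ℕ}

lemma MemH.of_abs_sub_le (hN : 0 < N) {w u φ : EuclideanSpace ℝ (Fin N) → ℝ} (hw : MemH w)
    (hu : MemH u) (hφ : Continuous φ) (hφ2 : MemLp φ 2)
    (h : ∀ x y, |φ x - φ y| ≤ |w x - w y| + |u x - u y|) : MemH φ := by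
  refine ⟨hφ2, ((hw.2.add hu.2).const_mul 2).mono' ?_ (Filter.Eventually.of_forall fun p => ?_)⟩
  · exact ((by fun_prop : Measurable fun p : EuclideanSpace ℝ (Fin N) ×
      EuclideanSpace ℝ (Fin N) => (φ p.1 - φ p.2) * (φ p.1 - φ p.2)).mul
      (measurable_kernelK.comp (measurable_fst.sub measurable_snd))).aestronglyMeasurable
  · have hk := kernelK_nonneg hN (p.1 - p.2)
    rw [Real.norm_of_nonneg (mul_nonneg (mul_self_nonneg _) hk)]
    simp only [Pi.add_apply]
    have h1 : (φ p.1 - φ p.2) * (φ p.1 - φ p.2) ≤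
        2 * ((w p.1 - w p.2) * (w p.1 - w p.2) + (u p.1 - u p.2) * (u p.1 - u p.2)) := by
      have h2 := mul_self_le_mul_self (abs_nonneg _) (h p.1 p.2)
      rw [abs_mul_abs_self] at h2
      have := abs_mul_abs_self (w p.1 - w p.2)
      have := abs_mul_abs_self (u p.1 - u p.2)
      nlinarith [sq_nonneg (|w p.1 - w p.2| - |u p.1 - u p.2|)]
    calc _ ≤ _ := mul_le_mul_of_nonneg_right h1 hk
      _ = _ := by ring

lemma MemH.integrable_energy (hN : 0 < N) {u v : EuclideanSpace ℝ (Fin N) → ℝ}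
    (hu : MemH u) (hv : MemH v) (huc : Continuous u) (hvc : Continuous v) :
    Integrable (fun p : EuclideanSpace ℝ (Fin N) × EuclideanSpace ℝ (Fin N) =>
      (u p.1 - u p.2) * (v p.1 - v p.2) * kernelK (p.1 - p.2)) := by
  refine (hu.2.add hv.2).mono' ?_ (Filter.Eventually.of_forall fun p => ?_)
  · exact ((by fun_prop : Measurable fun p : EuclideanSpace ℝ (Fin N) ×
      EuclideanSpace ℝ (Fin N) => (u p.1 - u p.2) * (v p.1 - v p.2)).mul
      (measurable_kernelK.comp (measurable_fst.sub measurable_snd))).aestronglyMeasurable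
  · have hk := kernelK_nonneg hN (p.1 - p.2)
    rw [norm_mul, Real.norm_of_nonneg hk, Real.norm_eq_abs, Pi.add_apply, ← add_mul]
    refine mul_le_mul_of_nonneg_right (abs_le.2 ⟨?_, ?_⟩) hk <;>
      nlinarith [sq_nonneg (u p.1 - u p.2 - (v p.1 - v p.2)),
        sq_nonneg (u p.1 - u p.2 + (v p.1 - v p.2)), sq_nonneg (u p.1 - u p.2),
        sq_nonneg (v p.1 - v p.2)]

lemma integrable_swap {f : EuclideanSpace ℝ (Fin N) × EuclideanSpace ℝ (Fin N) → ℝ}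
    (hf : Integrable f) :
    Integrable (fun p : EuclideanSpace ℝ (Fin N) × EuclideanSpace ℝ (Fin N) => f p.swap) := by
  rw [Measure.volume_eq_prod] at *
  exact hf.swap

lemma integral_swap (f : EuclideanSpace ℝ (Fin N) × EuclideanSpace ℝ (Fin N) → ℝ) :
    ∫ p : EuclideanSpace ℝ (Fin N) × EuclideanSpace ℝ (Fin N), f p.swap = ∫ p, f p := by
  rw [Measure.volume_eq_prod]
  exact integral_prod_swap f

/-- One factor of the squared difference is bounded by `L |x - y|`, the other by `w(x) + w(y)`; this
leaves `|z| k(z)` convolved with an integrable function. -/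
lemma memH_of_lipschitz [Nontrivial (EuclideanSpace ℝ (Fin N))] (hN : 0 < N)
    {w : EuclideanSpace ℝ (Fin N) → ℝ} {L : ℝ} (hL : ∀ x y, |w x - w y| ≤ L * ‖x - y‖)
    (hw : Continuous w) (hwc : HasCompactSupport w) (hw0 : ∀ x, 0 ≤ w x) : MemH w := by
  have ha := (integrable_mul_comp_sub (hw.integrable_of_hasCompactSupport hwc)
    (integrable_norm_mul_kernelK hN)).const_mul L
  refine ⟨hw.memLp_of_hasCompactSupport hwc, (ha.add (integrable_swap ha)).mono' ?_
    (Filter.Eventually.of_forall fun p => ?_)⟩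
  · exact ((by fun_prop : Measurable fun p : EuclideanSpace ℝ (Fin N) ×
      EuclideanSpace ℝ (Fin N) => (w p.1 - w p.2) * (w p.1 - w p.2)).mul
      (measurable_kernelK.comp (measurable_fst.sub measurable_snd))).aestronglyMeasurable
  · have hk := kernelK_nonneg hN (p.1 - p.2)
    rw [Real.norm_of_nonneg (mul_nonneg (mul_self_nonneg _) hk)]
    simp only [Pi.add_apply, Prod.fst_swap, Prod.snd_swap]
    rw [kernelK_sub_comm p.2 p.1, norm_sub_rev p.2 p.1]
    have h1 : (w p.1 - w p.2) * (w p.1 - w p.2) ≤ L * ‖p.1 - p.2‖ * (w p.1 + w p.2) := by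
      rw [← abs_mul_abs_self]
      refine mul_le_mul (hL _ _) ?_ (abs_nonneg _) ((abs_nonneg _).trans (hL p.1 p.2))
      rw [abs_le]; constructor <;> linarith [hw0 p.1, hw0 p.2]
    calc _ ≤ _ := mul_le_mul_of_nonneg_right h1 hk
      _ = _ := by ring

end EnergySpace

/-! ### Reflection in the hyperplane -/

section Reflection

variable {N : ℕ} {e : EuclideanSpace ℝ (Fin N)} {c : ℝ}

lemma inner_reflect (he : ‖e‖ = 1) (x : EuclideanSpace ℝ (Fin N)) :
    inner ℝ e (reflect e c x) = 2 * c - inner ℝ e x := by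
  rw [reflect, inner_sub_right, real_inner_smul_right, real_inner_self_eq_norm_sq, he]
  ring

lemma reflect_reflect (he : ‖e‖ = 1) (x : EuclideanSpace ℝ (Fin N)) :
    reflect e c (reflect e c x) = x := by
  conv_lhs => rw [reflect, inner_reflect he]
  rw [reflect]
  module

lemma continuous_reflect : Continuous (reflect e c) := by
  unfold reflect; fun_prop

lemma reflect_mem_halfSpace_iff (he : ‖e‖ = 1) {x : EuclideanSpace ℝ (Fin N)} :
    reflect e c x ∈ halfSpace e c ↔ inner ℝ e x < c := by
  rw [halfSpace, mem_ofPred_eq, inner_reflect he]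
  constructor <;> intro h <;> linarith

lemma reflect_notMem_halfSpace (he : ‖e‖ = 1) {x : EuclideanSpace ℝ (Fin N)}
    (hx : x ∈ halfSpace e c) : reflect e c x ∉ halfSpace e c := by
  rw [reflect_mem_halfSpace_iff he]
  exact not_lt.2 (le_of_lt hx)

lemma reflect_eq_self {x : EuclideanSpace ℝ (Fin N)} (hx : inner ℝ e x = c) :
    reflect e c x = x := by
  simp [reflect, hx]

lemma measurePreserving_reflect (he : ‖e‖ = 1) :
    MeasurePreserving (reflect e c) (volume : Measure (EuclideanSpace ℝ (Fin N))) volume := by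
  have h := (measurePreserving_add_right (volume : Measure (EuclideanSpace ℝ (Fin N)))
    ((2 * c) • e)).comp (LinearIsometryEquiv.measurePreserving (Submodule.reflection (ℝ ∙ e)ᗮ))
  suffices h' : reflect e c = (fun x => x + (2 * c) • e) ∘ (Submodule.reflection (ℝ ∙ e)ᗮ) by
    rw [h']; exact h
  funext x
  rw [Function.comp_apply, Submodule.reflection_orthogonal_apply,
    Submodule.reflection_singleton_apply, he, reflect]
  simp only [one_pow, RCLike.ofReal_real_eq_id, id, div_one]
  module

/-- The squared distances differ by `4 (⟨e,x⟩ - c)(⟨e,y⟩ - c)`, which is positive inside the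
half-space. -/
lemma norm_sub_lt_norm_reflect_sub (he : ‖e‖ = 1) {x y : EuclideanSpace ℝ (Fin N)}
    (hx : x ∈ halfSpace e c) (hy : y ∈ halfSpace e c) : ‖x - y‖ < ‖reflect e c x - y‖ := by
  have hx' : c < inner ℝ e x := hx
  have hy' : c < inner ℝ e y := hy
  have h : ‖reflect e c x - y‖ ^ 2 =
      ‖x - y‖ ^ 2 + 4 * (inner ℝ e x - c) * (inner ℝ e y - c) := by
    have : reflect e c x - y = (x - y) - (2 * (inner ℝ e x - c)) • e := by
      rw [reflect]; abel
    rw [this, norm_sub_sq_real, norm_smul, he, real_inner_smul_right,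
      real_inner_comm e (x - y), inner_sub_right, mul_one, Real.norm_eq_abs, sq_abs]
    ring
  refine lt_of_pow_lt_pow_left₀ 2 (norm_nonneg _) ?_
  rw [h]
  nlinarith [mul_pos (sub_pos.2 hx') (sub_pos.2 hy')]

lemma isOpen_halfSpace : IsOpen (halfSpace e c) :=
  isOpen_lt continuous_const (by fun_prop)

lemma IsAntisymmetric.reflect_eq_neg {u : EuclideanSpace ℝ (Fin N) → ℝ}
    (hu : IsAntisymmetric e c u) (huc : Continuous u) (x : EuclideanSpace ℝ (Fin N)) :
    u (reflect e c x) = -u x :=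
  congr_fun ((Continuous.ae_eq_iff_eq volume (huc.comp continuous_reflect) huc.neg).1 hu) x

end Reflection

/-! ### Lower bound for the potential of the far part -/

section LowerBound

variable {N : ℕ} {e : EuclideanSpace ℝ (Fin N)} {c : ℝ}

lemma exists_ball_kernel_bounds (hN : 0 < N) (he : ‖e‖ = 1) {u : EuclideanSpace ℝ (Fin N) → ℝ}
    (huc : Continuous u) {x₀ x₁ : EuclideanSpace ℝ (Fin N)} (h₀ : x₀ ∈ halfSpace e c)
    (h₁ : x₁ ∈ halfSpace e c) (hne : x₁ ≠ x₀) (hu₁ : 0 < u x₁) :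
    ∃ δ > 0, ∃ s > 0, ∀ x ∈ ball x₁ s, ∀ y ∈ ball x₀ s, x ∈ halfSpace e c ∧
      δ ≤ u x * (kernelFull (x - y) - kernelFull (reflect e c x - y)) := by
  have hr : ∀ {x y : EuclideanSpace ℝ (Fin N)}, x ∈ halfSpace e c → y ∈ halfSpace e c →
      reflect e c x - y ≠ 0 := fun hx hy h =>
    reflect_notMem_halfSpace he hx (by rwa [sub_eq_zero.1 h])
  let F : EuclideanSpace ℝ (Fin N) × EuclideanSpace ℝ (Fin N) → ℝ := fun p =>
    u p.1 * (kernelFull (p.1 - p.2) - kernelFull (reflect e c p.1 - p.2))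
  have hF : ContinuousAt F (x₁, x₀) := by
    have hc : Continuous (reflect e c) := continuous_reflect
    refine (huc.comp continuous_fst).continuousAt.mul (ContinuousAt.sub ?_ ?_)
    · exact ContinuousAt.comp (f := fun p : _ × _ => p.1 - p.2)
        (continuousAt_kernelFull (sub_ne_zero.2 hne)) (by fun_prop)
    · exact ContinuousAt.comp (f := fun p : _ × _ => reflect e c p.1 - p.2)
        (continuousAt_kernelFull (hr h₁ h₀)) (by fun_prop)
  have hpos : 0 < F (x₁, x₀) := mul_pos hu₁ (sub_pos.2 (kernelFull_lt_of_norm_lt hN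
    (sub_ne_zero.2 hne) (norm_sub_lt_norm_reflect_sub he h₁ h₀)))
  have hev := (hF.eventually (lt_mem_nhds (half_lt_self hpos))).and
    (continuousAt_fst.eventually (isOpen_halfSpace.mem_nhds h₁))
  obtain ⟨s, hs, hs'⟩ := Metric.eventually_nhds_iff_ball.1 hev
  refine ⟨F (x₁, x₀) / 2, half_pos hpos, s, hs, fun x hx y hy => ?_⟩
  have := hs' (x, y) (by rw [← ball_prod_same]; exact ⟨hx, hy⟩)
  exact ⟨this.2, this.1.le⟩

/-- Controls the loss from the mirror image of the removed ball: `x̄ - y` stays away from the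
singularity when `x` and `y` are near `x₀`. -/
lemma exists_ball_reflected_bound (he : ‖e‖ = 1)
    {u : EuclideanSpace ℝ (Fin N) → ℝ} (huc : Continuous u) {x₀ : EuclideanSpace ℝ (Fin N)}
    (h₀ : x₀ ∈ halfSpace e c) :
    ∃ C > 0, ∃ s > 0, ∀ x ∈ ball x₀ s, ∀ y ∈ ball x₀ s,
      u x * kernelFull (reflect e c x - y) ≤ C := by
  let F : EuclideanSpace ℝ (Fin N) × EuclideanSpace ℝ (Fin N) → ℝ := fun p =>
    u p.1 * kernelFull (reflect e c p.1 - p.2)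
  have hF : ContinuousAt F (x₀, x₀) := by
    have hc : Continuous (reflect e c) := continuous_reflect
    refine (huc.comp continuous_fst).continuousAt.mul ?_
    refine ContinuousAt.comp (f := fun p : _ × _ => reflect e c p.1 - p.2)
        (continuousAt_kernelFull fun h => ?_) (by fun_prop)
    exact reflect_notMem_halfSpace he h₀ (by rwa [sub_eq_zero.1 h])
  obtain ⟨s, hs, hs'⟩ := Metric.eventually_nhds_iff_ball.1
    (hF.eventually (gt_mem_nhds (lt_of_le_of_lt (le_abs_self _) (lt_add_one |F (x₀, x₀)|))))
  refine ⟨|F (x₀, x₀)| + 1, by positivity, s, hs, fun x hx y hy => ?_⟩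
  exact (hs' (x, y) (by rw [← ball_prod_same]; exact ⟨hx, hy⟩)).le

lemma indicator_mul_kernelOff {u : EuclideanSpace ℝ (Fin N) → ℝ}
    {x₀ y : EuclideanSpace ℝ (Fin N)} {r : ℝ} (hy : y ∈ closedBall x₀ r)
    (x : EuclideanSpace ℝ (Fin N)) :
    (ball x₀ (2 * r))ᶜ.indicator u x * kernelOff r (x - y) =
      (ball x₀ (2 * r))ᶜ.indicator u x * kernelFull (x - y) := by
  by_cases hx : x ∈ ball x₀ (2 * r)
  · simp [hx]
  · have : x - y ∈ (ball (0 : EuclideanSpace ℝ (Fin N)) r)ᶜ := by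
      rw [mem_compl_iff, mem_ball_zero_iff, not_lt, ← dist_eq_norm]
      rw [mem_ball, not_lt] at hx
      rw [mem_closedBall] at hy
      linarith [dist_triangle x y x₀]
    rw [kernelOff, indicator_of_mem this]

/-- Near a point `x₀` of the half-space, the potential of the part of an antisymmetric function
off a small ball about `x₀` is bounded below. -/
lemma exists_le_integral_indicator_mul_kernelOff [Nontrivial (EuclideanSpace ℝ (Fin N))]
    (hN : 0 < N) (he : ‖e‖ = 1)
    {u : EuclideanSpace ℝ (Fin N) → ℝ} (huc : Continuous u) (hu2 : MemLp u 2)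
    (hanti : ∀ x, u (reflect e c x) = -u x) (hnn : ∀ x ∈ halfSpace e c, 0 ≤ u x)
    {x₀ x₁ : EuclideanSpace ℝ (Fin N)} (h₁ : x₁ ∈ halfSpace e c) (hne : x₁ ≠ x₀) (hu₁ : 0 < u x₁)
    {Ω : Set (EuclideanSpace ℝ (Fin N))} (hΩ : IsOpen Ω) (hΩH : Ω ⊆ halfSpace e c)
    (h₀ : x₀ ∈ Ω) :
    ∃ m > 0, ∃ r > 0, ball x₀ (2 * r) ⊆ Ω ∧ ∀ y ∈ closedBall x₀ r,
      m ≤ ∫ x, (ball x₀ (2 * r))ᶜ.indicator u x * kernelOff r (x - y) := by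
  obtain ⟨δ, hδ, s, hs, hK⟩ := exists_ball_kernel_bounds hN he huc (hΩH h₀) h₁ hne hu₁
  obtain ⟨C, hC, s', hs', hB⟩ := exists_ball_reflected_bound he huc (hΩH h₀)
  obtain ⟨s'', hs'', hsΩ⟩ := Metric.isOpen_iff.1 hΩ x₀ h₀
  have hd : 0 < dist x₁ x₀ := dist_pos.2 hne
  set q := min s (dist x₁ x₀ / 2) with hq
  have hq0 : 0 < q := lt_min hs (half_pos hd)
  set a := volume.real (ball x₁ q)
  have ha : 0 < a := ENNReal.toReal_pos (measure_ball_pos _ _ hq0).ne' measure_ball_lt_top.ne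
  -- The loss is of order `C |B|` and vanishes with `r`, whereas the gain `δ * a` is fixed
  -- beforehand.
  have htend : Filter.Tendsto (fun r : ℝ => C * volume.real (ball x₀ (2 * r)))
      (nhdsWithin 0 (Ioi 0)) (nhds 0) := by
    have hc : Filter.Tendsto (fun r : ℝ => C * ((2 * r) ^ N *
        volume.real (ball (0 : EuclideanSpace ℝ (Fin N)) 1))) (nhdsWithin 0 (Ioi 0)) (nhds 0) := by
      have : Continuous (fun r : ℝ => C * ((2 * r) ^ N *
        volume.real (ball (0 : EuclideanSpace ℝ (Fin N)) 1))) := by fun_prop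
      simpa [hN.ne'] using (this.tendsto 0).mono_left nhdsWithin_le_nhds
    refine hc.congr' (eventually_nhdsWithin_of_forall fun r hr => ?_)
    have hr' : 0 ≤ 2 * r := by linarith [mem_Ioi.1 hr]
    beta_reduce
    rw [measureReal_def, measureReal_def, Measure.addHaar_ball volume x₀ hr',
      finrank_euclideanSpace_fin, ENNReal.toReal_mul, ENNReal.toReal_ofReal (by positivity)]
  have hsmall : ∀ σ : ℝ, 0 < σ → ∀ᶠ r : ℝ in nhdsWithin 0 (Ioi 0), 2 * r < σ := fun σ hσ => by
    filter_upwards [Ioo_mem_nhdsGT (half_pos hσ)] with r hr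
    linarith [hr.2]
  obtain ⟨r, hrC, hrs, hrs', hrs'', hrd, hr0⟩ :=
    ((htend.eventually (gt_mem_nhds (by positivity : 0 < δ * a / 4))).and
      ((hsmall s hs).and ((hsmall s' hs').and ((hsmall s'' hs'').and ((hsmall _ (half_pos hd)).and
        self_mem_nhdsWithin))))).exists
  have hr : (0 : ℝ) < r := hr0
  set B := ball x₀ (2 * r)
  have hBΩ : B ⊆ Ω := (ball_subset_ball hrs''.le).trans hsΩ
  have hBH : B ⊆ halfSpace e c := hBΩ.trans hΩH
  refine ⟨δ * a / 4, by positivity, r, hr, hBΩ, fun y hy => ?_⟩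
  have hyB : y ∈ B := closedBall_subset_ball (by linarith) hy
  have hyH := hBH hyB
  set g : EuclideanSpace ℝ (Fin N) → ℝ := fun x => Bᶜ.indicator u x * kernelOff r (x - y) with hg
  have hgB : ∀ x ∈ B, g x = 0 := fun x hx => by simp [hg, hx]
  have hgB' : ∀ x, x ∉ B → g x = u x * kernelFull (x - y) := fun x hx => by
    rw [hg]
    dsimp only
    rw [indicator_mul_kernelOff hy, indicator_of_mem (mem_compl hx)]
  have hgi : Integrable g := integrable_mul_comp_sub_right
    (hu2.indicator measurableSet_ball.compl) (memLp_kernelOff hN hr) y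
  have hmp := measurePreserving_reflect (c := c) he
  have hgi' : Integrable (fun x => g (reflect e c x)) := hmp.integrable_comp_of_integrable hgi
  have hemb : MeasurableEmbedding (reflect e c) :=
    (MeasurableEquiv.mk ⟨reflect e c, reflect e c, reflect_reflect he, reflect_reflect he⟩
      continuous_reflect.measurable continuous_reflect.measurable).measurableEmbedding
  have hgeq : ∫ x, g (reflect e c x) = ∫ x, g x := hmp.integral_comp hemb g
  -- Both radii, `q` and `2r`, are at most half of `dist x₁ x₀`, the second strictly.
  have hKB : ∀ x ∈ ball x₁ q, x ∉ B := fun x hx hxB => by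
    rw [mem_ball] at hx hxB
    have := dist_triangle_left x₁ x₀ x
    have := hq ▸ min_le_right s (dist x₁ x₀ / 2)
    linarith
  have hKH : ∀ x ∈ ball x₁ q, x ∈ halfSpace e c ∧
      δ ≤ u x * (kernelFull (x - y) - kernelFull (reflect e c x - y)) := fun x hx =>
    hK x (ball_subset_ball (min_le_left _ _) hx) y (ball_subset_ball hrs.le hyB)
  -- For `x ∈ B` the value at `x` has been cut away, so the negative contribution of `x̄` is
  -- uncompensated and costs at most `C`.
  have hpt : ∀ x ∈ halfSpace e c, (ball x₁ q).indicator (fun _ => δ) x -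
      B.indicator (fun _ => C) x ≤ g x + g (reflect e c x) := fun x hx => by
    have hxr : reflect e c x ∉ B := fun h => reflect_notMem_halfSpace he hx (hBH h)
    rw [hgB' _ hxr, hanti]
    by_cases hxB : x ∈ B
    · have hxK : x ∉ ball x₁ q := fun h => hKB x h hxB
      rw [hgB x hxB, indicator_of_notMem hxK, indicator_of_mem hxB]
      linarith [hB x (ball_subset_ball hrs'.le hxB) y (ball_subset_ball hrs'.le hyB)]
    · rw [hgB' x hxB, indicator_of_notMem hxB]
      by_cases hxK : x ∈ ball x₁ q
      · rw [indicator_of_mem hxK]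
        linarith [(hKH x hxK).2]
      · rw [indicator_of_notMem hxK]
        -- Strict kernel comparison fails at `x = y`, where `kernelFull` takes the value `0`.
        have hne' : x ≠ y := fun h => hxB (h ▸ hyB)
        have := mul_nonneg (hnn x hx) (sub_pos.2 (kernelFull_lt_of_norm_lt hN (sub_ne_zero.2 hne')
          (norm_sub_lt_norm_reflect_sub he hx hyH))).le
        linarith
  -- The bound is spread over the whole space so that reflection invariance of the integral applies;
  -- the extra term covers the mirror image of `B`.
  have hpt' : ∀ x, (ball x₁ q).indicator (fun _ => δ) x - B.indicator (fun _ => C) x -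
      B.indicator (fun _ => C) (reflect e c x) ≤ g x + g (reflect e c x) := fun x => by
    have hn1 : 0 ≤ B.indicator (fun _ => C) (reflect e c x) :=
      indicator_nonneg (fun _ _ => hC.le) _
    rcases lt_trichotomy c (inner ℝ e x) with hx | hx | hx
    · linarith [hpt x hx]
    · have hxH : x ∉ halfSpace e c := fun h => absurd hx (ne_of_lt h)
      have hxB : x ∉ B := fun h => hxH (hBH h)
      have hu0 : u x = 0 := by
        have := hanti x
        rw [reflect_eq_self hx.symm] at this
        linarith
      rw [reflect_eq_self hx.symm, hgB' x hxB, hu0, indicator_of_notMem hxB,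
        indicator_of_notMem fun h => hxH (hKH x h).1]
      simp
    · have h := hpt _ ((reflect_mem_halfSpace_iff he).2 hx)
      have hxH : x ∉ halfSpace e c := fun h => lt_asymm h hx
      rw [reflect_reflect he] at h
      rw [indicator_of_notMem fun h => hxH (hKH x h).1,
        indicator_of_notMem fun h => hxH (hBH h)]
      have : 0 ≤ (ball x₁ q).indicator (fun _ => δ) (reflect e c x) :=
        indicator_nonneg (fun _ _ => hδ.le) _
      linarith
  have hiK : Integrable ((ball x₁ q).indicator (fun _ => δ)) :=
    (integrableOn_const measure_ball_lt_top.ne).integrable_indicator measurableSet_ball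
  have hiB : Integrable (B.indicator (fun _ => C)) :=
    (integrableOn_const measure_ball_lt_top.ne).integrable_indicator measurableSet_ball
  have hiB' : Integrable (fun x => B.indicator (fun _ => C) (reflect e c x)) :=
    hmp.integrable_comp_of_integrable hiB
  have hmono := integral_mono ((hiK.sub hiB).sub hiB') (hgi.add hgi') hpt'
  have e1 : ∫ x, ((ball x₁ q).indicator (fun _ => δ) - B.indicator (fun _ => C) -
      fun x => B.indicator (fun _ => C) (reflect e c x)) x =
      a * δ - volume.real B * C - volume.real B * C := by
    rw [integral_sub' (hiK.sub hiB) hiB', integral_sub' hiK hiB,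
      hmp.integral_comp hemb (B.indicator fun _ => C),
      integral_indicator_const _ measurableSet_ball, integral_indicator_const _ measurableSet_ball]
    rfl
  rw [e1, integral_add' hgi hgi', hgeq] at hmono
  -- Twice the potential is at least `a δ - 2 C |B|`, and `C |B| < δ a / 4`.
  linarith

end LowerBound

/-! ### Upper bound for the form on the test function -/

section UpperBound

variable {N : ℕ}

/-- Testing the form with the positive part of `w - |u|`, for a Lipschitz bump function `w`
supported near a point about which `u` is nonnegative. -/
lemma energyL_le [Nontrivial (EuclideanSpace ℝ (Fin N))] (hN : 0 < N)
    {u w φ : EuclideanSpace ℝ (Fin N) → ℝ} (huc : Continuous u) (hu : MemH u)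
    {x₀ : EuclideanSpace ℝ (Fin N)} {r L ε : ℝ} (hr : 0 < r)
    (hnn : ∀ x ∈ ball x₀ (2 * r), 0 ≤ u x)
    (hL : ∀ x y, |w x - w y| ≤ L * ‖x - y‖)
    (hwε : ∀ x, w x ≤ ε) (hwr : ∀ x ∉ closedBall x₀ r, w x = 0)
    (hφ : ∀ x, φ x = max (w x - |u x|) 0) (hφc : Continuous φ) (hφi : Integrable φ)
    (hφH : MemH φ) :
    energyL u φ ≤ (L * (∫ z : EuclideanSpace ℝ (Fin N), ‖z‖ * kernelK z) + |rhoN N| * ε) *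
        (∫ y, φ y) -
      ∫ y, φ y * ∫ x, (ball x₀ (2 * r))ᶜ.indicator u x * kernelOff r (x - y) := by
  set t : EuclideanSpace ℝ (Fin N) → ℝ := (ball x₀ (2 * r))ᶜ.indicator u with ht
  have ht2 : MemLp t 2 := hu.1.indicator measurableSet_ball.compl
  have hφ0 : ∀ x, 0 ≤ φ x := fun x => by rw [hφ]; exact le_max_right _ _
  have hφr : ∀ x ∉ closedBall x₀ r, φ x = 0 := fun x hx => by
    rw [hφ, hwr x hx, zero_sub, max_eq_right (neg_nonpos.2 (abs_nonneg _))]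
  have hsub : closedBall x₀ r ⊆ ball x₀ (2 * r) := closedBall_subset_ball (by linarith)
  have htu : ∀ x, t x ≤ u x := fun x => by
    by_cases hx : x ∈ ball x₀ (2 * r)
    · rw [ht, indicator_of_notMem (by simpa using hx)]; exact hnn x hx
    · rw [ht, indicator_of_mem hx]
  -- on the support of `φ`, `t` vanishes and `0 ≤ u = w - φ`
  have hsupp : ∀ x, 0 < φ x → t x = 0 ∧ 0 ≤ u x ∧ u x = w x - φ x := fun x hx => by
    have hx' : x ∈ ball x₀ (2 * r) := hsub (by_contra fun h => hx.ne' (hφr x h))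
    have h0 := hnn x hx'
    refine ⟨by rw [ht, indicator_of_notMem (by simpa using hx')], h0, ?_⟩
    have h1 := hφ x
    rw [abs_of_nonneg h0] at h1
    rcases max_choice (w x - u x) 0 with h | h <;> rw [h] at h1 <;> linarith
  have hzero : ∀ x, φ x = 0 → w x - u x ≤ -t x := fun x hx => by
    by_cases hx' : x ∈ ball x₀ (2 * r)
    · rw [ht, indicator_of_notMem (by simpa using hx'), neg_zero, ← abs_of_nonneg (hnn x hx'), ← hx,
        hφ]
      exact le_max_left _ _
    · rw [ht, indicator_of_mem hx', hwr x fun h => hx' (hsub h)]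
      linarith
  -- If both values of `φ` are positive, substituting `u = w - φ` leaves a term in `w` and the
  -- nonpositive `-(φ x - φ y)²`. If only one is, `hzero` at the other point supplies the term in
  -- `t`.
  have hpt : ∀ x y, (u x - u y) * (φ x - φ y) ≤
      L * ‖x - y‖ * φ x + L * ‖x - y‖ * φ y - t x * φ y - t y * φ x := fun x y => by
    have hw1 := (le_abs_self _).trans (hL x y)
    have hw2 := (neg_abs_le _).trans' (neg_le_neg (hL x y))
    rcases (hφ0 x).eq_or_lt with hx | hx <;> rcases (hφ0 y).eq_or_lt with hy | hy
    · rw [← hx, ← hy]; simp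
    · obtain ⟨h1, h2, h3⟩ := hsupp y hy
      have h4 := hzero x hx.symm
      rw [← hx, h1, h3]
      nlinarith
    · obtain ⟨h1, h2, h3⟩ := hsupp x hx
      have h4 := hzero y hy.symm
      rw [← hy, h1, h3]
      nlinarith
    · obtain ⟨h1, h2, h3⟩ := hsupp x hx
      obtain ⟨h1', h2', h3'⟩ := hsupp y hy
      rw [h1, h1', h3, h3']
      nlinarith [sq_nonneg (φ x - φ y)]
  -- the integrals entering the estimate
  set A := ∫ z : EuclideanSpace ℝ (Fin N), ‖z‖ * kernelK z
  set a : EuclideanSpace ℝ (Fin N) × EuclideanSpace ℝ (Fin N) → ℝ :=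
    fun p => L * (φ p.2 * (‖p.1 - p.2‖ * kernelK (p.1 - p.2))) with ha
  set b : EuclideanSpace ℝ (Fin N) × EuclideanSpace ℝ (Fin N) → ℝ :=
    fun p => t p.1 * φ p.2 * kernelK (p.1 - p.2) with hb
  set d : EuclideanSpace ℝ (Fin N) × EuclideanSpace ℝ (Fin N) → ℝ :=
    fun p => t p.1 * φ p.2 * kernelJ (p.1 - p.2) with hd
  have hai : Integrable a :=
    (integrable_mul_comp_sub hφi (integrable_norm_mul_kernelK hN)).const_mul L
  have haI : ∫ p, a p = L * (A * ∫ y, φ y) := by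
    rw [ha, integral_const_mul, integral_mul_comp_sub hφi (integrable_norm_mul_kernelK hN)]
  -- `kernelJ` unfolds to `kernelOff 1`.
  have hdi : Integrable d := integrable_mul_mul_comp_sub ht2 hφi (memLp_kernelOff hN one_pos)
  have hbd : ∀ p, b p + d p = t p.1 * φ p.2 * kernelOff r (p.1 - p.2) := fun p => by
    rw [hb, hd]
    dsimp only
    rw [← mul_add, kernelK_add_kernelJ]
    by_cases hp : p.2 ∈ closedBall x₀ r
    · rw [mul_right_comm, mul_right_comm _ _ (kernelOff _ _), ht, indicator_mul_kernelOff hp]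
    · simp [hφr _ hp]
  have hfull : Integrable (fun p : EuclideanSpace ℝ (Fin N) × EuclideanSpace ℝ (Fin N) =>
      t p.1 * φ p.2 * kernelOff r (p.1 - p.2)) :=
    integrable_mul_mul_comp_sub ht2 hφi (memLp_kernelOff hN hr)
  -- `kernelK` need not be square integrable near the origin, so `b` is handled as a difference: `t`
  -- and `φ` have separated supports and only the kernel off radius `r` is seen.
  have hbi : Integrable b := (hfull.sub hdi).congr (Filter.Eventually.of_forall fun p => by
    rw [Pi.sub_apply, ← hbd p]; ring)
  have hbdI : (∫ p, b p) + ∫ p, d p = ∫ y, φ y * ∫ x, t x * kernelOff r (x - y) := by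
    rw [← integral_add hbi hdi, ← integral_mul_mul_comp_sub ht2 hφi (memLp_kernelOff hN hr)]
    exact integral_congr_ae (Filter.Eventually.of_forall hbd)
  have h1 : energy u φ ≤ (∫ p, a p) - ∫ p, b p := by
    have hle := integral_mono (hu.integrable_energy hN hφH huc hφc)
      (((integrable_swap hai).add hai).sub (hbi.add (integrable_swap hbi))) (fun p => by
        have := mul_le_mul_of_nonneg_right (hpt p.1 p.2) (kernelK_nonneg hN (p.1 - p.2))
        refine this.trans (le_of_eq ?_)
        simp only [ha, hb, Pi.add_apply, Pi.sub_apply, Prod.fst_swap, Prod.snd_swap]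
        rw [kernelK_sub_comm p.2 p.1, norm_sub_rev p.2 p.1]
        ring)
    rw [integral_sub' ((integrable_swap hai).add hai) (hbi.add (integrable_swap hbi)),
      integral_add' (integrable_swap hai) hai, integral_add' hbi (integrable_swap hbi),
      integral_swap, integral_swap] at hle
    rw [energy]
    linarith
  -- Discarding `u` on the ball, where it is nonnegative, only lowers the `j` integral.
  have h2 : ∫ p, d p ≤ ∫ p : EuclideanSpace ℝ (Fin N) × EuclideanSpace ℝ (Fin N),
      u p.1 * φ p.2 * kernelJ (p.1 - p.2) :=
    integral_mono hdi (integrable_mul_mul_comp_sub hu.1 hφi (memLp_kernelOff hN one_pos)) fun p =>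
      mul_le_mul_of_nonneg_right (mul_le_mul_of_nonneg_right (htu _) (hφ0 _)) (kernelJ_nonneg hN _)
  have h3 : rhoN N * ∫ x, u x * φ x ≤ |rhoN N| * (ε * ∫ x, φ x) := by
    have hb : ‖∫ x, u x * φ x‖ ≤ ∫ x, ε * φ x := by
      refine norm_integral_le_of_norm_le (hφi.const_mul ε) (Filter.Eventually.of_forall fun x => ?_)
      rw [norm_mul, Real.norm_of_nonneg (hφ0 x)]
      rcases (hφ0 x).eq_or_lt with hx | hx
      · rw [← hx]; simp
      · obtain ⟨-, h2, h3⟩ := hsupp x hx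
        rw [Real.norm_of_nonneg h2]
        exact mul_le_mul_of_nonneg_right (by linarith [hwε x]) (hφ0 x)
    rw [integral_const_mul] at hb
    calc rhoN N * ∫ x, u x * φ x ≤ |rhoN N * ∫ x, u x * φ x| := le_abs_self _
      _ = |rhoN N| * ‖∫ x, u x * φ x‖ := by rw [abs_mul, Real.norm_eq_abs]
      _ ≤ _ := mul_le_mul_of_nonneg_left hb (abs_nonneg _)
  rw [energyL, ← hbdI]
  linarith

end UpperBound

/-! ### The cone used as barrier -/

section Bump

variable {N : ℕ}

/-- The cone of height `ε` over the ball of radius `r` about `x₀`. -/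
noncomputable def cone (x₀ : EuclideanSpace ℝ (Fin N)) (r ε : ℝ) (x : EuclideanSpace ℝ (Fin N)) :
    ℝ :=
  max (ε - ε / r * ‖x - x₀‖) 0

variable {x₀ : EuclideanSpace ℝ (Fin N)} {r ε : ℝ}

lemma cone_nonneg (x : EuclideanSpace ℝ (Fin N)) : 0 ≤ cone x₀ r ε x := le_max_right _ _

lemma cone_le (hr : 0 < r) (hε : 0 < ε) (x : EuclideanSpace ℝ (Fin N)) : cone x₀ r ε x ≤ ε :=
  max_le (sub_le_self _ (by positivity)) hε.le

lemma continuous_cone : Continuous (cone x₀ r ε) := by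
  unfold cone; fun_prop

lemma cone_eq_zero (hr : 0 < r) (hε : 0 < ε) {x : EuclideanSpace ℝ (Fin N)}
    (hx : x ∉ closedBall x₀ r) : cone x₀ r ε x = 0 := by
  rw [mem_closedBall, dist_eq_norm, not_le] at hx
  refine max_eq_right (sub_nonpos.2 ?_)
  calc ε = ε / r * r := by field_simp
    _ ≤ _ := mul_le_mul_of_nonneg_left hx.le (by positivity)

lemma abs_cone_sub_cone_le (hr : 0 < r) (hε : 0 < ε) (x y : EuclideanSpace ℝ (Fin N)) :
    |cone x₀ r ε x - cone x₀ r ε y| ≤ ε / r * ‖x - y‖ := by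
  refine (abs_max_sub_max_le_abs _ _ _).trans ?_
  have h : ε - ε / r * ‖x - x₀‖ - (ε - ε / r * ‖y - x₀‖) = ε / r * (‖y - x₀‖ - ‖x - x₀‖) := by ring
  rw [h, abs_mul, abs_of_pos (by positivity : 0 < ε / r)]
  refine mul_le_mul_of_nonneg_left ((abs_norm_sub_norm_le _ _).trans (le_of_eq ?_)) (by positivity)
  rw [sub_sub_sub_cancel_right, norm_sub_rev]

end Bump

/-! ### Strong maximum principle and conclusion -/

lemma exists_ae_abs_le_of_memLp_top {α : Type*} [MeasurableSpace α] {μ : Measure α} {V : α → ℝ}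
    (hV : MemLp V ⊤ μ) : ∃ M : ℝ, 0 ≤ M ∧ ∀ᵐ x ∂μ, |V x| ≤ M := by
  refine ⟨(eLpNorm V ⊤ μ).toReal, ENNReal.toReal_nonneg, ?_⟩
  have h := ae_le_eLpNormEssSup (f := V) (μ := μ)
  rw [← eLpNorm_exponent_top] at h
  filter_upwards [h] with x hx
  simpa using ENNReal.toReal_mono hV.2.ne hx

/-- Strong maximum principle: a nonnegative antisymmetric supersolution that vanishes at a point
of `Ω` vanishes on the whole half-space. -/
lemma eq_zero_on_halfSpace_of_eq_zero {N : ℕ} {e : EuclideanSpace ℝ (Fin N)} (he : ‖e‖ = 1) {c : ℝ}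
    {Ω : Set (EuclideanSpace ℝ (Fin N))} (hΩ : IsOpen Ω) (hΩH : Ω ⊆ halfSpace e c)
    {V : EuclideanSpace ℝ (Fin N) → ℝ} (hV : MemLp V ⊤ (volume.restrict Ω))
    {u : EuclideanSpace ℝ (Fin N) → ℝ} (huc : Continuous u)
    (hanti : ∀ x, u (reflect e c x) = -u x)
    (hsuper : IsWeakSupersolution Ω u (fun x => V x * u x))
    (hnn : ∀ x ∈ halfSpace e c, 0 ≤ u x) {x₀ : EuclideanSpace ℝ (Fin N)} (h₀ : x₀ ∈ Ω)
    (hu₀ : u x₀ = 0) {x₁ : EuclideanSpace ℝ (Fin N)} (h₁ : x₁ ∈ halfSpace e c) : u x₁ = 0 := by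
  by_contra hu₁
  have hu₁ : 0 < u x₁ := lt_of_le_of_ne (hnn x₁ h₁) (Ne.symm hu₁)
  have hne : x₁ ≠ x₀ := fun h => hu₁.ne' (h ▸ hu₀)
  have : Nontrivial (EuclideanSpace ℝ (Fin N)) := ⟨x₁, x₀, hne⟩
  have hN : 0 < N := Nat.pos_of_ne_zero fun h => by
    subst h
    exact hne (Subsingleton.elim _ _)
  have hu : MemH u := hsuper.1
  obtain ⟨m, hm, r, hr, hrΩ, hlow⟩ := exists_le_integral_indicator_mul_kernelOff hN he huc hu.1
    hanti hnn h₁ hne hu₁ hΩ hΩH h₀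
  obtain ⟨M, hM, hVM⟩ := exists_ae_abs_le_of_memLp_top hV
  set A := ∫ z : EuclideanSpace ℝ (Fin N), ‖z‖ * kernelK z with hA_def
  have hA0 : 0 ≤ A := integral_nonneg fun z => mul_nonneg (norm_nonneg _) (kernelK_nonneg hN z)
  -- `D` exceeds the total coefficient of `ε ∫ φ`: `M` from `V`, `A / r` from the cone's Lipschitz
  -- constant `ε / r`, and `|ρ_N|`. With `ε = m / (2 D)` the upper bound is at most `m / 2`.
  obtain ⟨D, hD⟩ : ∃ D, D = M + A / r + |rhoN N| + 1 := ⟨_, rfl⟩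
  have hD0 : 0 < D := by linarith [div_nonneg hA0 hr.le, abs_nonneg (rhoN N)]
  obtain ⟨ε, hε⟩ : ∃ ε, ε = m / (2 * D) := ⟨_, rfl⟩
  have hε0 : 0 < ε := hε ▸ div_pos hm (by linarith)
  set φ : EuclideanSpace ℝ (Fin N) → ℝ := fun x => max (cone x₀ r ε x - |u x|) 0 with hφ
  have hsub : closedBall x₀ r ⊆ Ω := (closedBall_subset_ball (by linarith)).trans hrΩ
  have hφc : Continuous φ := (continuous_cone.sub huc.abs).max continuous_const
  have hφ0 : ∀ x, 0 ≤ φ x := fun x => le_max_right _ _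
  have hφr : ∀ x ∉ closedBall x₀ r, φ x = 0 := fun x hx => by
    rw [hφ]
    dsimp only
    rw [cone_eq_zero hr hε0 hx, zero_sub, max_eq_right (neg_nonpos.2 (abs_nonneg _))]
  have hφcs : HasCompactSupport φ := HasCompactSupport.intro (isCompact_closedBall x₀ r) hφr
  have hφi : Integrable φ := hφc.integrable_of_hasCompactSupport hφcs
  have hwH : MemH (cone x₀ r ε) := memH_of_lipschitz hN (abs_cone_sub_cone_le hr hε0)
    continuous_cone (HasCompactSupport.intro (isCompact_closedBall x₀ r)
      fun x hx => cone_eq_zero hr hε0 hx) cone_nonneg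
  have hφH : MemH φ := hwH.of_abs_sub_le hN hu hφc (hφc.memLp_of_hasCompactSupport hφcs)
    fun x y => by
      refine (abs_max_sub_max_le_abs _ _ _).trans ?_
      rw [sub_sub_sub_comm]
      exact (abs_sub _ _).trans (add_le_add_right (abs_abs_sub_abs_le _ _) _)
  -- This is where `u x₀ = 0` is decisive: it gives `φ x₀ = ε`.
  have hφpos : 0 < ∫ x, φ x := hφc.integral_pos_of_hasCompactSupport_nonneg_nonzero hφcs hφ0
    (x := x₀) (by
      have : φ x₀ = ε := by simp [hφ, cone, hu₀, hε0.le]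
      rw [this]; exact hε0.ne')
  have hup := energyL_le hN huc hu hr (fun x hx => hnn x (hΩH (hrΩ hx)))
    (abs_cone_sub_cone_le hr hε0) (cone_le hr hε0)
    (fun x hx => cone_eq_zero hr hε0 hx) (fun x => rfl) hφc hφi hφH
  have hpot : m * ∫ y, φ y ≤
      ∫ y, φ y * ∫ x, (ball x₀ (2 * r))ᶜ.indicator u x * kernelOff r (x - y) := by
    rw [← integral_const_mul]
    refine integral_mono (hφi.const_mul m) (integrable_mul_integral_mul_comp_sub
      (hu.1.indicator measurableSet_ball.compl) hφi (memLp_kernelOff hN hr)) fun y => ?_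
    by_cases hy : y ∈ closedBall x₀ r
    · dsimp only
      rw [mul_comm m]
      exact mul_le_mul_of_nonneg_left (hlow y hy) (hφ0 y)
    · simp [hφr y hy]
  -- Where `φ > 0`, `u` lies below the cone and hence below `ε`.
  have hV' : -(M * ε * ∫ y, φ y) ≤ ∫ x in Ω, V x * u x * φ x := by
    have hb : ‖∫ x in Ω, V x * u x * φ x‖ ≤ ∫ x in Ω, M * ε * φ x := by
      refine norm_integral_le_of_norm_le (hφi.const_mul _).integrableOn ?_
      filter_upwards [hVM, ae_restrict_mem hΩ.measurableSet] with x hx hxΩ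
      have hux := hnn x (hΩH hxΩ)
      rw [norm_mul, norm_mul, Real.norm_of_nonneg (hφ0 x), Real.norm_of_nonneg hux,
        Real.norm_eq_abs]
      rcases (hφ0 x).eq_or_lt with h | h
      · rw [← h]; simp
      · have h1 : 0 < cone x₀ r ε x - |u x| := by
          rcases lt_max_iff.1 h with h | h
          · exact h
          · exact absurd h (lt_irrefl _)
        rw [abs_of_nonneg hux] at h1
        refine mul_le_mul_of_nonneg_right (mul_le_mul hx ?_ hux hM) h.le
        linarith [cone_le hr hε0 x (x₀ := x₀)]
    have hb' : ∫ x in Ω, M * ε * φ x = M * ε * ∫ y, φ y := by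
      rw [setIntegral_eq_integral_of_forall_compl_eq_zero, integral_const_mul]
      intro x hx
      rw [hφr x fun h => hx (hsub h), mul_zero]
    rw [hb'] at hb
    exact neg_le_of_abs_le hb
  have htest := hsuper.2 φ ⟨hφH, Filter.Eventually.of_forall fun x hx => hφr x fun h => hx (hsub h)⟩
    (Filter.Eventually.of_forall hφ0)
  have hfin : m * (∫ y, φ y) ≤ (ε * (M + A / r + |rhoN N|)) * ∫ y, φ y := by
    have : ε / r * A = ε * (A / r) := by ring
    rw [this] at hup
    linarith
  have h1 := le_of_mul_le_mul_right hfin hφpos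
  have h2 : ε * D = m / 2 := by rw [hε]; field_simp
  have h3 : ε * (M + A / r + |rhoN N|) ≤ ε * D := mul_le_mul_of_nonneg_left (by linarith) hε0.le
  linarith

end LogLap

theorem mainTheorem7 (N : ℕ) (e : EuclideanSpace ℝ (Fin N)) (he : ‖e‖ = 1) (c : ℝ)
    (Ω : Set (EuclideanSpace ℝ (Fin N))) (hΩ_open : IsOpen Ω) (hΩ_bdd : Bornology.IsBounded Ω)
    (hΩ_lip : LogLap.HasLipschitzBoundary Ω) (hΩH : Ω ⊆ LogLap.halfSpace e c)
    (V : EuclideanSpace ℝ (Fin N) → ℝ) (hV : MemLp V ⊤ (volume.restrict Ω))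
    (u : EuclideanSpace ℝ (Fin N) → ℝ) (hu_cont : Continuous u) (hu : LogLap.MemH u)
    (hu_anti : LogLap.IsAntisymmetric e c u)
    (hu_super : LogLap.IsWeakSupersolution Ω u (fun x => V x * u x))
    (hu_nonneg : ∀ x ∈ LogLap.halfSpace e c, 0 ≤ u x) :
    (∀ x ∈ Ω, 0 < u x) ∨ (∀ x, u x = 0) := by
  have hanti := hu_anti.reflect_eq_neg hu_cont
  refine or_iff_not_imp_left.2 fun h => ?_
  push Not at h
  obtain ⟨x₀, h₀, hle⟩ := h
  have hu₀ : u x₀ = 0 := le_antisymm hle (hu_nonneg x₀ (hΩH h₀))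
  have hH : ∀ x ∈ LogLap.halfSpace e c, u x = 0 := fun x hx =>
    LogLap.eq_zero_on_halfSpace_of_eq_zero he hΩ_open hΩH hV hu_cont hanti hu_super hu_nonneg h₀
      hu₀ hx
  intro x
  rcases lt_trichotomy c (inner ℝ e x) with hx | hx | hx
  · exact hH x hx
  · have := hanti x
    rw [LogLap.reflect_eq_self hx.symm] at this
    linarith
  · have := hH _ ((LogLap.reflect_mem_halfSpace_iff he).2 hx)
    rw [hanti] at this
    linarith
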